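/- Let $d\ge 0$ be an integer and $p\in[1,\infty)$ a real number. Write points of $\mathbb{R}^{d+1}$ as $(x,t)$ with $x\in\mathbb{R}^d$ and $t\in\mathbb{R}$, let $\|\cdot\|_p$ denote the $\ell^p$ norm, and let $P_p(\mathbb{R}^{d+1})$ be the set of Borel probability measures $\mu$ on $\mathbb{R}^{d+1}$ with $\int \|z_0-z\|_p^p\,d\mu(z)<\infty$ for every (equivalently, some) $z_0\in\mathbb{R}^{d+1}$. For $\alpha,\beta\in P_p(\mathbb{R}^{d+1})$ let $\Pi(\alpha,\beta)$ be the set of Borel probability measures on $\mathbb{R}^{d+1}\times\mathbb{R}^{d+1}$ with first marginal $\alpha$ and second marginal $\beta$. For $w\in[0,1]$ put $$d_{p,w}\big((x,t),(y,s)\big)=\big(w\|x-y\|_p^p+(1-w)|t-s|^p\big)^{1/p},$$ and define the time-integrated optimal transport distance $$\mathcal{D}_p(\alpha,\beta)=\sup_{w\in[0,1]}\left[\inf_{\pi\in\Pi(\alpha,\beta)}\int d_{p,w}(z,z')^p\,d\pi(z,z')\right]^{1/p}.$$ Then $\mathcal{D}_p$ is finite on $P_p(\mathbb{R}^{d+1})$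 and is a metric on it, and the metric space $(P_p(\mathbb{R}^{d+1}),\mathcal{D}_p)$ is complete and separable. -/

import Mathlib

open MeasureTheory

namespace TiOT

/-- The `ℓ^p` distance `‖z - z'‖_p` on `ℝⁿ`. -/
noncomputable def lpDist (p : ℝ) {n : ℕ} (z z' : Fin n → ℝ) : ℝ :=
  (∑ i, |z i - z' i| ^ p) ^ (1 / p)

/-- The feature part `x ∈ ℝ^d` of a point `(x, t) ∈ ℝ^{d+1}`. -/
def feature {d : ℕ} (z : Fin (d + 1) → ℝ) : Fin d → ℝ := fun i => z i.castSucc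

/-- The time part `t`, i.e. the last coordinate, of a point `(x, t) ∈ ℝ^{d+1}`. -/
def time {d : ℕ} (z : Fin (d + 1) → ℝ) : ℝ := z (Fin.last d)

/-- `d_{p,w}((x,t),(y,s)) = (w ‖x - y‖_p^p + (1 - w) |t - s|^p)^{1/p}`. -/
noncomputable def weightedDist (p w : ℝ) {d : ℕ} (z z' : Fin (d + 1) → ℝ) : ℝ :=
  (w * lpDist p (feature z) (feature z') ^ p + (1 - w) * |time z - time z'| ^ p) ^ (1 / p)

/-- `P_p(ℝ^{d+1})`: Borel probability measures on `ℝ^{d+1}` with finite `p`-th moment. -/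
def Pp (d : ℕ) (p : ℝ) : Type :=
  {μ : ProbabilityMeasure (Fin (d + 1) → ℝ) //
    ∀ z₀ : Fin (d + 1) → ℝ,
      ∫⁻ z, ENNReal.ofReal (lpDist p z₀ z ^ p) ∂(μ : Measure (Fin (d + 1) → ℝ)) < ⊤}

/-- `Π(α, β)`: probability measures on the product with marginals `α` and `β`. -/
def couplings {d : ℕ} (α β : ProbabilityMeasure (Fin (d + 1) → ℝ)) :
    Set (ProbabilityMeasure ((Fin (d + 1) → ℝ) × (Fin (d + 1) → ℝ))) :=
  {π | (π : Measure ((Fin (d + 1) → ℝ) × (Fin (d + 1) → ℝ))).map Prod.fst = α ∧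
    (π : Measure ((Fin (d + 1) → ℝ) × (Fin (d + 1) → ℝ))).map Prod.snd = β}

/-- `𝒲_{p,w}(α, β)`, the `p`-Wasserstein distance for the pseudometric `d_{p,w}`,
with values in `[0, ∞]`. -/
noncomputable def wasserstein (p w : ℝ) {d : ℕ} (α β : Pp d p) : ENNReal :=
  (⨅ π ∈ couplings α.1 β.1,
    ∫⁻ q, ENNReal.ofReal (weightedDist p w q.1 q.2 ^ p)
      ∂(π : Measure ((Fin (d + 1) → ℝ) × (Fin (d + 1) → ℝ)))) ^ (1 / p)

/-- The time-integrated optimal transport distance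
`𝒟_p(α, β) = sup_{w ∈ [0,1]} 𝒲_{p,w}(α, β)`, with values in `[0, ∞]`. -/
noncomputable def tiotDist {d : ℕ} {p : ℝ} (α β : Pp d p) : ENNReal :=
  ⨆ w ∈ Set.Icc (0 : ℝ) 1, wasserstein p w α β

end TiOT

/-! For each `w` the distance `d_{p,w}` is the `ℓ^p` norm of a linear rescaling of `z - z'`, so
transport costs are `L^p` norms of differences of random vectors. Every weight costs at most
`lpConst` times the `L^p` norm for the sup norm on `ℝ^{d+1}`, and the single weight `1/2` controls
that norm up to a factor `2`; hence `𝒟_p` is equivalent to an ordinary Wasserstein distance. The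
triangle inequality is proved weight by weight, by gluing couplings (`exists_measure_chain`) and
applying Minkowski. Definiteness is Chebyshev's inequality on closed sets. For completeness, the
couplings of a fast Cauchy sequence are glued into one measure on sequences, under which the
coordinates converge in `L^p`; the law of their limit is the limit. For separability, `P_p` is a
Lipschitz image of `L^p([0,1])`. Optimal couplings and weak compactness are never needed. -/

namespace TiOT

open ProbabilityTheory Filter Topology
open scoped ENNReal NNReal

/-! ### Gluing couplings along a Markov chain -/

/-- Pushing forward `ρ ⊗ₘ η.comap g` along `g` in the first variable. -/
theorem map_compProd_comap {A B C : Type*} [MeasurableSpace A] [MeasurableSpace B]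
    [MeasurableSpace C] (ρ : Measure A) [SFinite ρ] (η : Kernel B C) [IsSFiniteKernel η]
    {g : A → B} (hg : Measurable g) :
    (ρ ⊗ₘ η.comap g hg).map (Prod.map g id) = ρ.map g ⊗ₘ η := by
  ext s hs
  have hgid : Measurable (Prod.map g (id : C → C)) := hg.prodMap measurable_id
  rw [Measure.map_apply hgid hs, Measure.compProd_apply (hgid hs), Measure.compProd_apply hs,
    lintegral_map (Kernel.measurable_kernel_prodMk_left hs) hg]
  rfl

/-- The one-step transition law of a trajectory. -/
theorem map_partialTraj_succ_pair {E : Type*} [MeasurableSpace E]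
    (κ : (n : ℕ) → Kernel (Finset.Iic n → E) E) [∀ n, IsMarkovKernel (κ n)] (n : ℕ)
    (x : Finset.Iic n → E) :
    (Kernel.partialTraj (X := fun _ => E) κ n (n + 1) x).map
      (fun y => (y ⟨n, by simp⟩, y ⟨n + 1, by simp⟩)) =
      (κ n x).map (fun e => (x ⟨n, by simp⟩, e)) := by
  ext s hs
  have hI : Measurable (IicProdIoc (X := fun _ => E) n (n + 1)) := measurable_IicProdIoc
  rw [Kernel.partialTraj_succ_self, Measure.map_apply (by fun_prop) hs,
    Kernel.map_apply' _ hI _ (by exact hs.preimage (by fun_prop)),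
    Kernel.prod_apply, Kernel.id_apply, Kernel.map_apply _ (by fun_prop),
    Measure.dirac_prod, Measure.map_map (by fun_prop) (by fun_prop),
    Measure.map_apply (by fun_prop) (by exact (hs.preimage (by fun_prop)).preimage hI),
    Measure.map_apply (by fun_prop) hs]
  congr 1
  ext e
  simp [IicProdIoc, MeasurableEquiv.piSingleton]

/-- Gluing: a sequence of couplings with matching consecutive marginals is realised by a single
probability measure on the space of sequences. -/
theorem exists_measure_chain {E : Type*} [MeasurableSpace E] [StandardBorelSpace E] [Nonempty E]
    (π : ℕ → Measure (E × E)) [∀ n, IsProbabilityMeasure (π n)]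
    (h : ∀ n, (π n).snd = (π (n + 1)).fst) :
    ∃ P : Measure (ℕ → E), IsProbabilityMeasure P ∧
      ∀ n, P.map (fun x => (x n, x (n + 1))) = π n := by
  let ev : (n : ℕ) → (Finset.Iic n → E) → E := fun n x => x ⟨n, by simp⟩
  have hev : ∀ n, Measurable (ev n) := fun n => by fun_prop
  -- Markov chain: the next point depends on the past only through its last coordinate, by
  -- disintegration of `π n`. Ionescu-Tulcea then yields `P`.
  let κ : (n : ℕ) → Kernel (Finset.Iic n → E) E := fun n => (π n).condKernel.comap (ev n) (hev n)
  let ν : Measure (Finset.Iic 0 → E) := (π 0).fst.map (fun e _ => e)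
  have : IsProbabilityMeasure ν := Measure.isProbabilityMeasure_map (by fun_prop)
  let P : Measure (ℕ → E) := ν.bind (Kernel.traj (X := fun _ => E) κ 0)
  have hP : IsProbabilityMeasure P := by
    show IsProbabilityMeasure (ν.bind _)
    infer_instance
  let ρ : (n : ℕ) → Measure (Finset.Iic n → E) := fun n =>
    ν.bind (Kernel.partialTraj (X := fun _ => E) κ 0 n)
  have hρP : ∀ n, P.map (Preorder.frestrictLe (π := fun _ => E) n) = ρ n := fun n => by
    show (ν.bind _).map _ = ν.bind _
    rw [Measure.map_comp _ _ (by fun_prop), Kernel.traj_map_frestrictLe]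
  have hρprob : ∀ n, IsProbabilityMeasure (ρ n) := fun n => by
    rw [← hρP]
    exact Measure.isProbabilityMeasure_map (by fun_prop)
  have hstep : ∀ n, (ρ (n + 1)).map (fun y => (y ⟨n, by simp⟩, y ⟨n + 1, by simp⟩)) =
      (ρ n).map (ev n) ⊗ₘ (π n).condKernel := fun n => by
    have h1 : ρ (n + 1) = (ρ n).bind (Kernel.partialTraj (X := fun _ => E) κ n (n + 1)) := by
      show ν.bind _ = (ν.bind _).bind _
      rw [Kernel.partialTraj_succ_eq_comp (Nat.zero_le n), Measure.comp_assoc]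
    rw [h1, Measure.map_comp _ _ (by fun_prop), ← map_compProd_comap (ρ n) _ (hev n)]
    ext s hs
    have hgid : Measurable (Prod.map (ev n) (id : E → E)) := (hev n).prodMap measurable_id
    rw [Measure.bind_apply hs (Kernel.aemeasurable _), Measure.map_apply hgid hs,
      Measure.compProd_apply (hgid hs)]
    refine lintegral_congr fun x => ?_
    rw [Kernel.map_apply _ (by fun_prop), map_partialTraj_succ_pair,
      Measure.map_apply (by fun_prop) hs]
    rfl
  have hlaw : ∀ n, (ρ n).map (ev n) = (π n).fst := by
    intro n
    induction n with
    | zero =>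
      have : ρ 0 = ν := by
        show ν.bind _ = ν
        rw [Kernel.partialTraj_self, Measure.id_comp]
      rw [this, Measure.map_map (hev 0) (by fun_prop)]
      exact Measure.map_id
    | succ n ih =>
      have h2 := hstep n
      rw [ih, Measure.disintegrate] at h2
      rw [← h n, ← h2, Measure.snd, Measure.map_map (by fun_prop) (by fun_prop)]
      rfl
  refine ⟨P, hP, fun n => ?_⟩
  have h3 := hstep n
  rw [hlaw, Measure.disintegrate, ← hρP, Measure.map_map (by fun_prop) (by fun_prop)] at h3
  exact h3

/-! ### The weighted distances as norms -/

theorem one_le_ofReal_of_fact {p : ℝ} [hp : Fact (1 ≤ p)] : 1 ≤ ENNReal.ofReal p := by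
  simpa using ENNReal.ofReal_le_ofReal hp.out

instance factOneLeOfReal {p : ℝ} [Fact (1 ≤ p)] : Fact (1 ≤ ENNReal.ofReal p) :=
  ⟨one_le_ofReal_of_fact⟩

/-- The linear rescaling of `ℝ^{d+1}` that turns the distance `d_{p,w}` into the `ℓ^p` distance,
with values in the normed space `ℓ^p`. -/
noncomputable def rescale (p w : ℝ) {d : ℕ} (z : Fin (d + 1) → ℝ) :
    PiLp (ENNReal.ofReal p) (fun _ : Fin (d + 1) => ℝ) :=
  WithLp.toLp _ fun i => (if i = Fin.last d then 1 - w else w) ^ (1 / p) * z i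

variable {p w : ℝ} {d : ℕ}

theorem rescale_add (z z' : Fin (d + 1) → ℝ) :
    rescale p w (z + z') = rescale p w z + rescale p w z' := by
  ext i
  simp [rescale, mul_add]

theorem rescale_neg (z : Fin (d + 1) → ℝ) : rescale p w (-z) = -rescale p w z := by
  ext i
  simp [rescale]

theorem rescale_zero : rescale p w (0 : Fin (d + 1) → ℝ) = 0 := by
  ext i
  simp [rescale]

@[fun_prop]
theorem continuous_rescale : Continuous (rescale p w : (Fin (d + 1) → ℝ) → _) :=
  (PiLp.continuous_toLp _ _).comp (by fun_prop)

variable [hp : Fact (1 ≤ p)]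

theorem norm_toLp_ofReal {n : ℕ} (z : Fin n → ℝ) :
    ‖(WithLp.toLp (ENNReal.ofReal p) z : PiLp (ENNReal.ofReal p) (fun _ : Fin n => ℝ))‖ =
      (∑ i, |z i| ^ p) ^ (1 / p) := by
  have h0 : 0 ≤ p := zero_le_one.trans hp.out
  rw [PiLp.norm_eq_sum] <;> rw [ENNReal.toReal_ofReal h0]
  · rfl
  · exact zero_lt_one.trans_le hp.out

theorem lpDist_eq_norm {n : ℕ} (z z' : Fin n → ℝ) :
    lpDist p z z' = ‖(WithLp.toLp (ENNReal.ofReal p) (z - z') :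
      PiLp (ENNReal.ofReal p) (fun _ : Fin n => ℝ))‖ := by
  rw [norm_toLp_ofReal]
  rfl

theorem weightedDist_eq_norm (hw : w ∈ Set.Icc (0 : ℝ) 1) (z z' : Fin (d + 1) → ℝ) :
    weightedDist p w z z' = ‖rescale p w (z - z')‖ := by
  have h0 : p ≠ 0 := (zero_lt_one.trans_le hp.out).ne'
  have hpow : ∀ a b : ℝ, 0 ≤ a → |a ^ (1 / p) * b| ^ p = a * |b| ^ p := fun a b ha => by
    rw [abs_mul, Real.mul_rpow (abs_nonneg _) (abs_nonneg _), abs_of_nonneg (by positivity),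
      one_div, Real.rpow_inv_rpow ha h0]
  rw [rescale, norm_toLp_ofReal, weightedDist, lpDist, one_div,
    Real.rpow_inv_rpow (Finset.sum_nonneg fun i _ => by positivity) h0, Fin.sum_univ_castSucc,
    Finset.mul_sum]
  congr 2
  · refine Finset.sum_congr rfl fun i _ => ?_
    rw [if_neg (Fin.castSucc_lt_last i).ne, ← one_div, hpow _ _ hw.1]
    rfl
  · rw [if_pos rfl, ← one_div, hpow _ _ (sub_nonneg.2 hw.2)]
    rfl

variable (p d) in
/-- A Lipschitz constant of the inclusion of `ℝ^{d+1}` with the sup norm into `ℓ^p`. -/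
noncomputable def lpConst : ℝ≥0 :=
  (Fintype.card (Fin (d + 1)) : ℝ≥0) ^ (1 / ENNReal.ofReal p).toReal

theorem norm_toLp_le (z : Fin (d + 1) → ℝ) :
    ‖(WithLp.toLp (ENNReal.ofReal p) z :
      PiLp (ENNReal.ofReal p) (fun _ : Fin (d + 1) => ℝ))‖ ≤ lpConst p d * ‖z‖ := by
  simpa [lpConst] using (PiLp.lipschitzWith_toLp (ENNReal.ofReal p)
    (fun _ : Fin (d + 1) => ℝ)).dist_le_mul z 0

theorem norm_rescale_le (hw : w ∈ Set.Icc (0 : ℝ) 1) (z : Fin (d + 1) → ℝ) :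
    ‖rescale p w z‖ ≤ lpConst p d * ‖z‖ := by
  refine (norm_toLp_le _).trans (mul_le_mul_of_nonneg_left ?_ (NNReal.coe_nonneg _))
  refine (pi_norm_le_iff_of_nonneg (norm_nonneg _)).2 fun i => ?_
  have hc : (0 : ℝ) ≤ (if i = Fin.last d then 1 - w else w) ∧
      (if i = Fin.last d then 1 - w else w) ≤ 1 := by
    split_ifs
    · exact ⟨by linarith [hw.2], by linarith [hw.1]⟩
    · exact hw
  have h0 : 0 ≤ 1 / p := one_div_nonneg.2 (zero_le_one.trans hp.out)
  rw [norm_mul, Real.norm_of_nonneg (Real.rpow_nonneg hc.1 _)]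
  exact (mul_le_of_le_one_left (norm_nonneg _) (Real.rpow_le_one hc.1 hc.2 h0)).trans
    (norm_le_pi_norm z i)

/-- At `w = 1/2` all coordinates are scaled by the same nonzero factor, so the rescaling is
invertible; at `w = 0` or `w = 1` it can lose coordinates. -/
theorem norm_le_two_mul_norm_rescale (z : Fin (d + 1) → ℝ) :
    ‖z‖ ≤ 2 * ‖rescale p (1 / 2) z‖ := by
  refine (pi_norm_le_iff_of_nonneg (by positivity)).2 fun i => ?_
  have h := PiLp.norm_apply_le (rescale p (1 / 2) z) i
  have hhalf : (if i = Fin.last d then 1 - (1 / 2 : ℝ) else 1 / 2) = 1 / 2 := by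
    split_ifs <;> norm_num
  -- As `1 / p ≤ 1`, this makes the constant `2` serve for all `p`.
  have hle : (1 / 2 : ℝ) ≤ (1 / 2 : ℝ) ^ (1 / p) := by
    conv_lhs => rw [← Real.rpow_one (1 / 2 : ℝ)]
    exact Real.rpow_le_rpow_of_exponent_ge (by norm_num) (by norm_num)
      ((div_le_one (zero_lt_one.trans_le hp.out)).2 hp.out)
  have hi : (rescale p (1 / 2) z).ofLp i = (1 / 2 : ℝ) ^ (1 / p) * z i :=
    congrArg (fun c : ℝ => c ^ (1 / p) * z i) hhalf
  rw [hi, norm_mul, Real.norm_of_nonneg (by positivity)] at h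
  linarith [mul_le_mul_of_nonneg_right hle (norm_nonneg (z i))]

/-! ### Wasserstein distances for a fixed weight -/

theorem lintegral_rpow_norm_eq_eLpNorm {Ω F : Type*} [MeasurableSpace Ω] [NormedAddCommGroup F]
    (μ : Measure Ω) (f : Ω → F) :
    (∫⁻ ω, ENNReal.ofReal (‖f ω‖ ^ p) ∂μ) ^ (1 / p) = eLpNorm f (ENNReal.ofReal p) μ := by
  have h0 : 0 < p := zero_lt_one.trans_le hp.out
  rw [eLpNorm_eq_lintegral_rpow_enorm_toReal (by simpa using h0) ENNReal.ofReal_ne_top,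
    ENNReal.toReal_ofReal h0.le]
  simp_rw [← ENNReal.ofReal_rpow_of_nonneg (norm_nonneg _) h0.le, ofReal_norm]

/-- The `L^p` formulation of the Wasserstein distance. -/
theorem wasserstein_eq_iInf_eLpNorm (hw : w ∈ Set.Icc (0 : ℝ) 1) (α β : Pp d p) :
    wasserstein p w α β = ⨅ π ∈ couplings α.1 β.1,
      eLpNorm (fun q => rescale p w (q.1 - q.2)) (ENNReal.ofReal p)
        (π : Measure ((Fin (d + 1) → ℝ) × (Fin (d + 1) → ℝ))) := by
  have h0 : 0 < 1 / p := one_div_pos.2 (zero_lt_one.trans_le hp.out)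
  -- The power `1 / p` is an order isomorphism of `[0, ∞]`, so it passes through the infimum.
  have hmap := (ENNReal.orderIsoRpow (1 / p) h0).map_iInf₂
    fun (π : ProbabilityMeasure ((Fin (d + 1) → ℝ) × (Fin (d + 1) → ℝ)))
      (_ : π ∈ couplings α.1 β.1) =>
    ∫⁻ q, ENNReal.ofReal (weightedDist p w q.1 q.2 ^ p)
      ∂(π : Measure ((Fin (d + 1) → ℝ) × (Fin (d + 1) → ℝ)))
  simp only [ENNReal.orderIsoRpow_apply] at hmap
  rw [wasserstein, hmap]
  simp_rw [weightedDist_eq_norm hw, lintegral_rpow_norm_eq_eLpNorm]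

/-- The Wasserstein distance is at most the cost of any pair of random variables with the given
laws. -/
theorem wasserstein_le_eLpNorm (hw : w ∈ Set.Icc (0 : ℝ) 1) {α β : Pp d p} {Ω : Type*}
    [MeasurableSpace Ω] {P : Measure Ω} {X Y : Ω → Fin (d + 1) → ℝ}
    (hX : AEMeasurable X P) (hY : AEMeasurable Y P)
    (hα : P.map X = α.1) (hβ : P.map Y = β.1) :
    wasserstein p w α β ≤
      eLpNorm (fun ω => rescale p w (X ω - Y ω)) (ENNReal.ofReal p) P := by
  have hXY : AEMeasurable (fun ω => (X ω, Y ω)) P := hX.prodMk hY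
  have hP : IsProbabilityMeasure P := by
    refine ⟨?_⟩
    rw [← Set.preimage_univ (f := X), ← Measure.map_apply_of_aemeasurable hX MeasurableSet.univ, hα]
    exact measure_univ
  let π : ProbabilityMeasure ((Fin (d + 1) → ℝ) × (Fin (d + 1) → ℝ)) :=
    ⟨P.map (fun ω => (X ω, Y ω)), Measure.isProbabilityMeasure_map hXY⟩
  have hπ : π ∈ couplings α.1 β.1 := by
    constructor
    · show (P.map _).map _ = _
      rw [AEMeasurable.map_map_of_aemeasurable (by fun_prop) hXY]
      exact hα
    · show (P.map _).map _ = _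
      rw [AEMeasurable.map_map_of_aemeasurable (by fun_prop) hXY]
      exact hβ
  rw [wasserstein_eq_iInf_eLpNorm hw]
  refine (iInf₂_le π hπ).trans_eq ?_
  show eLpNorm _ _ (P.map _) = _
  rw [eLpNorm_map_measure (Continuous.aestronglyMeasurable (by fun_prop)) hXY]
  rfl

/-- Strictness supplies a coupling without the infimum having to be attained. -/
theorem exists_coupling_of_wasserstein_lt (hw : w ∈ Set.Icc (0 : ℝ) 1) {α β : Pp d p} {r : ℝ≥0∞}
    (h : wasserstein p w α β < r) :
    ∃ π : Measure ((Fin (d + 1) → ℝ) × (Fin (d + 1) → ℝ)), IsProbabilityMeasure π ∧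
      π.map Prod.fst = α.1 ∧ π.map Prod.snd = β.1 ∧
      eLpNorm (fun q => rescale p w (q.1 - q.2)) (ENNReal.ofReal p) π < r := by
  rw [wasserstein_eq_iInf_eLpNorm hw] at h
  simp only [iInf_lt_iff] at h
  obtain ⟨π, hπ, hlt⟩ := h
  exact ⟨π, inferInstance, hπ.1, hπ.2, hlt⟩

theorem wasserstein_self (hw : w ∈ Set.Icc (0 : ℝ) 1) (α : Pp d p) :
    wasserstein p w α α = 0 := by
  refine le_antisymm ((wasserstein_le_eLpNorm hw aemeasurable_id aemeasurable_id Measure.map_id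
    Measure.map_id).trans ?_) bot_le
  simp [rescale_zero]

theorem wasserstein_comm_le (hw : w ∈ Set.Icc (0 : ℝ) 1) (α β : Pp d p) :
    wasserstein p w α β ≤ wasserstein p w β α := by
  refine le_of_forall_gt fun r hr => ?_
  obtain ⟨π, _, hβ, hα, hlt⟩ := exists_coupling_of_wasserstein_lt hw hr
  refine (wasserstein_le_eLpNorm hw (by fun_prop) (by fun_prop) hα hβ).trans_lt ?_
  rwa [eLpNorm_congr_norm_ae (g := fun q => rescale p w (q.1 - q.2))]
  refine ae_of_all _ fun q => ?_
  rw [← neg_sub, rescale_neg, norm_neg]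

/-- Glue `π₁` and `π₂` along `β` into a law of `(x 0, x 1, x 2)`, then apply Minkowski to `x 0 - x 2
= (x 0 - x 1) + (x 1 - x 2)`. -/
theorem wasserstein_triangle (hw : w ∈ Set.Icc (0 : ℝ) 1) (α β γ : Pp d p) :
    wasserstein p w α γ ≤ wasserstein p w α β + wasserstein p w β γ := by
  rw [wasserstein_eq_iInf_eLpNorm hw α β, wasserstein_eq_iInf_eLpNorm hw β γ]
  simp_rw [ENNReal.iInf_add, ENNReal.add_iInf]
  refine le_iInf₂ fun π₁ h₁ => le_iInf₂ fun π₂ h₂ => ?_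
  let π : ℕ → Measure ((Fin (d + 1) → ℝ) × (Fin (d + 1) → ℝ)) := fun n =>
    match n with
    | 0 => π₁
    | 1 => π₂
    -- Padding: the chain stays at its third point, since the gluing lemma takes an infinite
    -- sequence.
    | _ + 2 => (γ.1 : Measure (Fin (d + 1) → ℝ)).map fun z => (z, z)
  have hπ : ∀ n, IsProbabilityMeasure (π n) := fun n =>
    match n with
    | 0 => inferInstanceAs (IsProbabilityMeasure π₁.toMeasure)
    | 1 => inferInstanceAs (IsProbabilityMeasure π₂.toMeasure)
    | _ + 2 => Measure.isProbabilityMeasure_map (by fun_prop)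
  have hfst : ((γ.1 : Measure (Fin (d + 1) → ℝ)).map fun z => (z, z)).fst = γ.1 := by
    rw [Measure.fst, Measure.map_map (by fun_prop) (by fun_prop)]
    exact Measure.map_id
  have hsnd : ((γ.1 : Measure (Fin (d + 1) → ℝ)).map fun z => (z, z)).snd = γ.1 := by
    rw [Measure.snd, Measure.map_map (by fun_prop) (by fun_prop)]
    exact Measure.map_id
  obtain ⟨P, hP, hlaw⟩ := exists_measure_chain π fun n =>
    match n with
    | 0 => h₁.2.trans h₂.1.symm
    | 1 => h₂.2.trans hfst.symm
    | _ + 2 => hsnd.trans hfst.symm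
  have hl₁ : P.map (fun x => (x 0, x 1)) = π₁ := hlaw 0
  have hl₂ : P.map (fun x => (x 1, x 2)) = π₂ := hlaw 1
  have hα : P.map (fun x => x 0) = α.1 := by
    rw [← h₁.1, ← hl₁, Measure.map_map (by fun_prop) (by fun_prop)]
    rfl
  have hγ : P.map (fun x => x 2) = γ.1 := by
    rw [← h₂.2, ← hl₂, Measure.map_map (by fun_prop) (by fun_prop)]
    rfl
  refine (wasserstein_le_eLpNorm hw (measurable_pi_apply 0).aemeasurable
    (measurable_pi_apply 2).aemeasurable hα hγ).trans ?_
  rw [← hl₁, ← hl₂,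
    eLpNorm_map_measure (Continuous.aestronglyMeasurable (by fun_prop)) (by fun_prop),
    eLpNorm_map_measure (Continuous.aestronglyMeasurable (by fun_prop)) (by fun_prop)]
  have hsum : (fun x : ℕ → Fin (d + 1) → ℝ => rescale p w (x 0 - x 2)) =
      ((fun q : (Fin (d + 1) → ℝ) × (Fin (d + 1) → ℝ) => rescale p w (q.1 - q.2)) ∘
        fun x : ℕ → Fin (d + 1) → ℝ => (x 0, x 1)) +
      ((fun q : (Fin (d + 1) → ℝ) × (Fin (d + 1) → ℝ) => rescale p w (q.1 - q.2)) ∘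
        fun x : ℕ → Fin (d + 1) → ℝ => (x 1, x 2)) := by
    ext1 x
    simp [← rescale_add]
  rw [hsum]
  exact eLpNorm_add_le (Continuous.aestronglyMeasurable (by fun_prop))
    (Continuous.aestronglyMeasurable (by fun_prop)) one_le_ofReal_of_fact

/-! ### Elements of `P_p` as laws of `L^p` random vectors -/

/-- The law of an `L^p` random vector has finite `p`-th moments. -/
theorem lintegral_lpDist_lt_top_of_memLp {Ω : Type*} [MeasurableSpace Ω] {P : Measure Ω}
    [IsFiniteMeasure P] {X : Ω → Fin (d + 1) → ℝ} (hX : MemLp X (ENNReal.ofReal p) P)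
    (z₀ : Fin (d + 1) → ℝ) :
    ∫⁻ z, ENNReal.ofReal (lpDist p z₀ z ^ p) ∂(P.map X) < ⊤ := by
  have h0 : 0 < 1 / p := one_div_pos.2 (zero_lt_one.trans_le hp.out)
  rw [← ENNReal.rpow_lt_top_iff_of_pos h0]
  simp_rw [lpDist_eq_norm]
  rw [lintegral_rpow_norm_eq_eLpNorm,
    eLpNorm_map_measure (Continuous.aestronglyMeasurable (by fun_prop)) hX.1.aemeasurable]
  refine (eLpNorm_le_mul_eLpNorm_of_ae_le_mul (g := fun ω => z₀ - X ω)
    (ae_of_all _ fun ω => norm_toLp_le _) _).trans_lt ?_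
  exact ENNReal.mul_lt_top ENNReal.ofReal_lt_top ((memLp_const z₀).sub hX).2

/-- The law of an `L^p` random vector, as an element of `P_p`. -/
noncomputable def law {Ω : Type*} [MeasurableSpace Ω] (P : Measure Ω) [IsProbabilityMeasure P]
    (X : Ω → Fin (d + 1) → ℝ) (hX : MemLp X (ENNReal.ofReal p) P) : Pp d p :=
  ⟨⟨P.map X, Measure.isProbabilityMeasure_map hX.1.aemeasurable⟩,
    lintegral_lpDist_lt_top_of_memLp hX⟩

theorem memLp_id (α : Pp d p) :
    MemLp (id : (Fin (d + 1) → ℝ) → _) (ENNReal.ofReal p) (α.1 : Measure (Fin (d + 1) → ℝ)) := by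
  have h0 : 0 < 1 / p := one_div_pos.2 (zero_lt_one.trans_le hp.out)
  have h := α.2 0
  rw [← ENNReal.rpow_lt_top_iff_of_pos h0] at h
  simp_rw [lpDist_eq_norm] at h
  rw [lintegral_rpow_norm_eq_eLpNorm] at h
  refine MemLp.of_le_mul (c := 1) (g := fun z : Fin (d + 1) → ℝ =>
    (WithLp.toLp (ENNReal.ofReal p) (0 - z) :
      PiLp (ENNReal.ofReal p) (fun _ : Fin (d + 1) => ℝ)))
    ⟨Continuous.aestronglyMeasurable (by fun_prop), h⟩ aestronglyMeasurable_id
    (ae_of_all _ fun z => (pi_norm_le_iff_of_nonneg (by positivity)).2 fun i => ?_)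
  have := PiLp.norm_apply_le (WithLp.toLp (ENNReal.ofReal p) (0 - z) :
      PiLp (ENNReal.ofReal p) (fun _ : Fin (d + 1) => ℝ)) i
  simpa using this

theorem memLp_of_map_eq {Ω : Type*} [MeasurableSpace Ω] {P : Measure Ω}
    {X : Ω → Fin (d + 1) → ℝ} (hX : AEMeasurable X P) {α : Pp d p} (h : P.map X = α.1) :
    MemLp X (ENNReal.ofReal p) P := by
  have hid := memLp_id α
  rw [← h, memLp_map_measure_iff aestronglyMeasurable_id hX] at hid
  exact hid

/-- The bound on the rescaling is uniform in `w`, so one pair `X`, `Y` serves the whole supremum. -/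
theorem tiotDist_le_mul_eLpNorm {α β : Pp d p} {Ω : Type*} [MeasurableSpace Ω] {P : Measure Ω}
    {X Y : Ω → Fin (d + 1) → ℝ} (hX : AEMeasurable X P) (hY : AEMeasurable Y P)
    (hα : P.map X = α.1) (hβ : P.map Y = β.1) :
    tiotDist α β ≤ lpConst p d * eLpNorm (X - Y) (ENNReal.ofReal p) P := by
  refine iSup₂_le fun w hw => (wasserstein_le_eLpNorm hw hX hY hα hβ).trans ?_
  have := eLpNorm_le_mul_eLpNorm_of_ae_le_mul (μ := P) (g := X - Y)
    (ae_of_all _ fun ω => norm_rescale_le (p := p) hw (X ω - Y ω)) (ENNReal.ofReal p)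
  rwa [ENNReal.ofReal_coe_nnreal] at this

/-- The independent coupling already has finite cost. -/
theorem tiotDist_ne_top (α β : Pp d p) : tiotDist α β ≠ ⊤ := by
  have hα : ((α.1 : Measure (Fin (d + 1) → ℝ)).prod (β.1 : Measure (Fin (d + 1) → ℝ))).map
      Prod.fst = α.1 := by simp
  have hβ : ((α.1 : Measure (Fin (d + 1) → ℝ)).prod (β.1 : Measure (Fin (d + 1) → ℝ))).map
      Prod.snd = β.1 := by simp
  refine ((tiotDist_le_mul_eLpNorm (by fun_prop) (by fun_prop) hα hβ).trans_lt
    (ENNReal.mul_lt_top ENNReal.coe_lt_top ?_)).ne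
  exact ((memLp_of_map_eq (by fun_prop) hα).sub (memLp_of_map_eq (by fun_prop) hβ)).2

theorem half_mem_Icc : (1 / 2 : ℝ) ∈ Set.Icc (0 : ℝ) 1 := by norm_num

/-- A coupling that is almost optimal for the weight `1 / 2` is small in `L^p`. -/
theorem exists_coupling_of_tiotDist_lt {α β : Pp d p} {r : ℝ≥0∞} (h : tiotDist α β < r) :
    ∃ π : Measure ((Fin (d + 1) → ℝ) × (Fin (d + 1) → ℝ)), IsProbabilityMeasure π ∧
      π.map Prod.fst = α.1 ∧ π.map Prod.snd = β.1 ∧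
      eLpNorm (fun q => q.1 - q.2) (ENNReal.ofReal p) π ≤ 2 * r := by
  have hle : wasserstein p (1 / 2) α β ≤ tiotDist α β :=
    le_iSup₂ (f := fun w (_ : w ∈ Set.Icc (0 : ℝ) 1) => wasserstein p w α β) _ half_mem_Icc
  obtain ⟨π, hπ, hα, hβ, hlt⟩ := exists_coupling_of_wasserstein_lt half_mem_Icc (hle.trans_lt h)
  refine ⟨π, hπ, hα, hβ, ?_⟩
  have hmul := eLpNorm_le_mul_eLpNorm_of_ae_le_mul (μ := π)
    (ae_of_all _ fun q => norm_le_two_mul_norm_rescale (p := p) (q.1 - q.2)) (ENNReal.ofReal p)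
  refine hmul.trans ?_
  rw [ENNReal.ofReal_ofNat]
  gcongr

/-! ### Metric axioms for `𝒟_p` -/

theorem tiotDist_self (α : Pp d p) : tiotDist α α = 0 := by
  simp only [tiotDist, ENNReal.iSup_eq_zero]
  exact fun w hw => wasserstein_self hw α

theorem tiotDist_comm (α β : Pp d p) : tiotDist α β = tiotDist β α :=
  iSup_congr fun _ => iSup_congr fun hw =>
    le_antisymm (wasserstein_comm_le hw α β) (wasserstein_comm_le hw β α)

theorem tiotDist_triangle (α β γ : Pp d p) : tiotDist α γ ≤ tiotDist α β + tiotDist β γ :=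
  iSup₂_le fun w hw => (wasserstein_triangle hw α β γ).trans (add_le_add
    (le_iSup₂ (f := fun w (_ : w ∈ Set.Icc (0 : ℝ) 1) => wasserstein p w α β) w hw)
    (le_iSup₂ (f := fun w (_ : w ∈ Set.Icc (0 : ℝ) 1) => wasserstein p w β γ) w hw))

/-- Laws at distance zero have couplings within `L^p` distance `2 ε²`, so Chebyshev's inequality
controls the mass of a closed set by the mass of its `ε`-thickening. -/
theorem measure_le_measure_cthickening_add {α β : Pp d p} (h : tiotDist α β = 0)
    (F : Set (Fin (d + 1) → ℝ)) (hF : IsClosed F) {ε : ℝ} (hε : 0 < ε) :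
    (α.1 : Measure (Fin (d + 1) → ℝ)) F ≤
      (β.1 : Measure (Fin (d + 1) → ℝ)) (Metric.cthickening ε F) + ENNReal.ofReal (2 * ε) := by
  -- Chebyshev at level `ε` divides by `ε`; starting from `ε * ε` leaves the error `2 * ε`, which
  -- vanishes with `ε`.
  have hlt : tiotDist α β < ENNReal.ofReal (ε * ε) := by
    rw [h]
    exact ENNReal.ofReal_pos.2 (by positivity)
  obtain ⟨π, hπ, hα, hβ, hle⟩ := exists_coupling_of_tiotDist_lt hlt
  have hone : eLpNorm (fun q : (Fin (d + 1) → ℝ) × (Fin (d + 1) → ℝ) => q.1 - q.2) 1 π ≤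
      2 * ENNReal.ofReal (ε * ε) :=
    (eLpNorm_le_eLpNorm_of_exponent_le one_le_ofReal_of_fact
      (Continuous.aestronglyMeasurable (by fun_prop))).trans hle
  have hcheb := meas_ge_le_mul_pow_eLpNorm_enorm π one_ne_zero ENNReal.one_ne_top
    (f := fun q : (Fin (d + 1) → ℝ) × (Fin (d + 1) → ℝ) => q.1 - q.2)
    (Continuous.aestronglyMeasurable (by fun_prop)) (ε := ENNReal.ofReal ε)
    (ENNReal.ofReal_pos.2 hε).ne' (by simp)
  rw [ENNReal.toReal_one, ENNReal.rpow_one, ENNReal.rpow_one] at hcheb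
  have hfar : π {q | ENNReal.ofReal ε ≤ ‖q.1 - q.2‖ₑ} ≤ ENNReal.ofReal (2 * ε) := by
    refine hcheb.trans ((mul_le_mul_right hone _).trans_eq ?_)
    rw [← ENNReal.ofReal_inv_of_pos hε, ← ENNReal.ofReal_ofNat 2,
      ← ENNReal.ofReal_mul (by norm_num), ← ENNReal.ofReal_mul (by positivity)]
    congr 1
    field_simp
  rw [← hα, ← hβ, Measure.map_apply measurable_fst hF.measurableSet,
    Measure.map_apply measurable_snd Metric.isClosed_cthickening.measurableSet]
  refine (measure_mono fun q hq => ?_).trans ((measure_union_le _ _).trans (by gcongr))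
  by_cases hq' : ENNReal.ofReal ε ≤ ‖q.1 - q.2‖ₑ
  · exact Or.inr hq'
  · refine Or.inl (Metric.mem_cthickening_of_edist_le q.2 q.1 ε F hq ?_)
    rw [edist_comm, edist_eq_enorm_sub]
    exact (not_le.1 hq').le

/-- Let `ε → 0`: the thickenings of a closed set decrease to the set itself. -/
theorem measure_le_of_tiotDist_eq_zero {α β : Pp d p} (h : tiotDist α β = 0)
    {F : Set (Fin (d + 1) → ℝ)} (hF : IsClosed F) :
    (α.1 : Measure (Fin (d + 1) → ℝ)) F ≤ (β.1 : Measure (Fin (d + 1) → ℝ)) F := by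
  have h1 := tendsto_measure_cthickening_of_isClosed
    (μ := (β.1 : Measure (Fin (d + 1) → ℝ))) ⟨1, one_pos, measure_ne_top _ _⟩ hF
  have h2 : Tendsto (fun ε : ℝ => ENNReal.ofReal (2 * ε)) (𝓝 0) (𝓝 0) := by
    have : Continuous fun ε : ℝ => ENNReal.ofReal (2 * ε) :=
      ENNReal.continuous_ofReal.comp (by fun_prop)
    simpa using this.tendsto 0
  have h3 := (h1.add h2).mono_left (nhdsWithin_le_nhds (s := Set.Ioi 0))
  rw [add_zero] at h3
  exact ge_of_tendsto h3 (eventually_nhdsWithin_of_forall fun ε hε =>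
    measure_le_measure_cthickening_add h F hF hε)

/-- By symmetry the two laws agree on closed sets, a π-system generating the Borel sets. -/
theorem eq_of_tiotDist_eq_zero {α β : Pp d p} (h : tiotDist α β = 0) : α = β := by
  refine Subtype.ext (Subtype.ext ?_)
  have : IsProbabilityMeasure α.1.1 := α.1.2
  have : IsProbabilityMeasure β.1.1 := β.1.2
  refine ext_of_generate_finite {s | IsClosed s}
    (BorelSpace.measurable_eq.trans borel_eq_generateFrom_isClosed) isPiSystem_isClosed
    (fun s hs => le_antisymm (measure_le_of_tiotDist_eq_zero h hs)
      (measure_le_of_tiotDist_eq_zero (tiotDist_comm α β ▸ h) hs)) ?_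
  exact measure_univ.trans measure_univ.symm

/-- The extended metric structure on `P_p` given by `𝒟_p`. -/
@[reducible]
noncomputable def tiotEMetricSpace : EMetricSpace (Pp d p) where
  edist := tiotDist
  edist_self := tiotDist_self
  edist_comm := tiotDist_comm
  edist_triangle := tiotDist_triangle
  eq_of_edist_eq_zero := eq_of_tiotDist_eq_zero

-- Completeness and separability

attribute [local instance] tiotEMetricSpace

theorem completeSpace_tiot : CompleteSpace (Pp d p) := by
  -- Only sequences with `𝒟_p(u n, u m)` below a summable tolerance need to converge; summability
  -- makes the glued coordinates Cauchy in `L^p`.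
  refine EMetric.complete_of_convergent_controlled_sequences (fun n => 2⁻¹ ^ n)
    (fun n => ENNReal.pow_pos (by simp) n) fun u hu => ?_
  have hex : ∀ n, ∃ π : Measure ((Fin (d + 1) → ℝ) × (Fin (d + 1) → ℝ)),
      IsProbabilityMeasure π ∧ π.map Prod.fst = (u n).1 ∧ π.map Prod.snd = (u (n + 1)).1 ∧
      eLpNorm (fun q => q.1 - q.2) (ENNReal.ofReal p) π ≤ 2 * 2⁻¹ ^ n := fun n =>
    exists_coupling_of_tiotDist_lt (hu n n (n + 1) le_rfl n.le_succ)
  choose π hπ hfst hsnd hle using hex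
  obtain ⟨P, hP, hlaw⟩ := exists_measure_chain π fun n => (hsnd n).trans (hfst (n + 1)).symm
  have hmap : ∀ n, P.map (fun x => x n) = (u n).1 := fun n => by
    rw [← hfst n, ← hlaw n, Measure.map_map (by fun_prop) (by fun_prop)]
    rfl
  have hmeas : ∀ n, AEMeasurable (fun x : ℕ → Fin (d + 1) → ℝ => x n) P := fun n =>
    (measurable_pi_apply n).aemeasurable
  have hmem : ∀ n, MemLp (fun x : ℕ → Fin (d + 1) → ℝ => x n) (ENNReal.ofReal p) P := fun n =>
    memLp_of_map_eq (hmeas n) (hmap n)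
  have hcauchy : CauchySeq fun n => (hmem n).toLp := by
    refine cauchySeq_of_edist_le_of_tsum_ne_top (fun n => 2 * 2⁻¹ ^ n) (fun n => ?_) ?_
    · rw [Lp.edist_toLp_toLp]
      refine le_trans (le_of_eq ?_) (hle n)
      rw [← hlaw n,
        eLpNorm_map_measure (Continuous.aestronglyMeasurable (by fun_prop)) (by fun_prop)]
      rfl
    · rw [ENNReal.tsum_mul_left, ENNReal.tsum_geometric]
      simp [ENNReal.mul_eq_top]
  obtain ⟨g, hg⟩ := cauchySeq_tendsto_of_complete hcauchy
  refine ⟨law P g (Lp.memLp g), ?_⟩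
  rw [tendsto_iff_edist_tendsto_0] at hg ⊢
  have hlim : Tendsto (fun n => (lpConst p d : ℝ≥0∞) * edist (hmem n).toLp g) atTop (𝓝 0) := by
    simpa using ENNReal.Tendsto.const_mul hg (Or.inr ENNReal.coe_ne_top)
  refine tendsto_of_tendsto_of_tendsto_of_le_of_le tendsto_const_nhds hlim (fun _ => bot_le)
    fun n => ?_
  refine (tiotDist_le_mul_eLpNorm (hmeas n) (Lp.memLp g).1.aemeasurable (hmap n) rfl).trans ?_
  have hedist := Lp.edist_toLp_toLp _ _ (hmem n) (Lp.memLp g)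
  rw [Lp.toLp_coeFn] at hedist
  exact (congrArg _ hedist.symm).le

/-- Every Borel law on `ℝ^{d+1}` is the image of Lebesgue measure on `[0,1]`, so taking laws maps
the separable space `L^p([0,1])` onto `P_p`, and this map is Lipschitz. -/
theorem separableSpace_tiot : TopologicalSpace.SeparableSpace (Pp d p) := by
  let f : Lp (Fin (d + 1) → ℝ) (ENNReal.ofReal p) (volume : Measure unitInterval) → Pp d p :=
    fun g => law volume g (Lp.memLp g)
  have hlip : LipschitzWith (lpConst p d) f := fun g g' => by
    refine (tiotDist_le_mul_eLpNorm (Lp.memLp g).1.aemeasurable (Lp.memLp g').1.aemeasurable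
      rfl rfl).trans ?_
    rw [Lp.edist_def]
  have hsurj : Function.Surjective f := fun α => by
    obtain ⟨X, hX, hmap⟩ := (α.1 : Measure (Fin (d + 1) → ℝ)).exists_measurable_map_eq
    have hmem := memLp_of_map_eq hX.aemeasurable hmap
    refine ⟨hmem.toLp, Subtype.ext (Subtype.ext ?_)⟩
    exact (Measure.map_congr hmem.coeFn_toLp).trans hmap
  have : Fact (ENNReal.ofReal p ≠ ⊤) := ⟨ENNReal.ofReal_ne_top⟩
  exact hsurj.denseRange.separableSpace hlip.continuous

end TiOT

theorem mainTheorem4 (d : ℕ) (p : ℝ) (hp : 1 ≤ p) :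
    (∀ α β : TiOT.Pp d p, TiOT.tiotDist α β ≠ ⊤) ∧
    ∃ m : MetricSpace (TiOT.Pp d p),
      (∀ α β : TiOT.Pp d p, m.dist α β = (TiOT.tiotDist α β).toReal) ∧
      @CompleteSpace (TiOT.Pp d p) m.toPseudoMetricSpace.toUniformSpace ∧
      @TopologicalSpace.SeparableSpace (TiOT.Pp d p)
        m.toPseudoMetricSpace.toUniformSpace.toTopologicalSpace := by
  have : Fact (1 ≤ p) := ⟨hp⟩
  refine ⟨TiOT.tiotDist_ne_top,
    -- This metric keeps the uniformity of the extended metric definitionally, so completeness and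
    -- separability carry over unchanged.
    @EMetricSpace.toMetricSpace _ TiOT.tiotEMetricSpace TiOT.tiotDist_ne_top,
    fun α β => rfl, TiOT.completeSpace_tiot, TiOT.separableSpace_tiot⟩
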